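/- For $n \ge 0$ let $\alpha_n = \sum_{k=0}^n \binom{n}{k}^2\binom{n+k}{n}^2$ be the $n$-th Apéry number. For a prime $p$ let $A_p \in \mathbb{F}_p[t]$ be the truncation at order $p$ of the reduction modulo $p$ of the Apéry series $\sum_{n\ge 0}\alpha_n t^n$, that is, $A_p = \sum_{n=0}^{p-1} (\alpha_n \bmod p)\, t^n$. Then for every prime $p$ there exists a polynomial $B_p \in \mathbb{F}_p[t]$ such that - if $p \equiv 1, 5, 7, 11 \pmod{24}$, then $A_p = B_p^2$; - if $p \equiv 13, 17, 19, 23 \pmod{24}$, then $A_p = (t^2 - 34t + 1)\cdot B_p^2$. -/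

import Mathlib

open Polynomial

/-- The Apéry numbers `α_n = ∑_{k=0}^n (n choose k)² (n+k choose n)²`. -/
def aperyNumber (n : ℕ) : ℕ :=
  ∑ k ∈ Finset.range (n + 1), n.choose k ^ 2 * (n + k).choose n ^ 2

/-- The Apéry series `f_α = ∑_{n ≥ 0} α_n tⁿ`, a power series with integer coefficients. -/
def aperySeries : PowerSeries ℤ :=
  PowerSeries.mk fun n => (aperyNumber n : ℤ)

/-- The truncation at order `p` (the terms of exponent `0, …, p - 1`) of the reduction
modulo `p` of the Apéry series, a polynomial over `𝔽_p`. -/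
noncomputable def aperyTrunc (p : ℕ) : (ZMod p)[X] :=
  PowerSeries.trunc p (PowerSeries.map (Int.castRingHom (ZMod p)) aperySeries)

/-! The Apéry differential equation is the pullback, along t = x(1 - 8x)/(1 + x), of the symmetric
square of a second-order Heun equation. Modulo p > 3 the latter has a polynomial solution f, and
A_p(t) = f(x)²/(1 + x)^(p-1).

To build f, choose m with 3m + 1 = p or 3m + 2 = p. Then m(m + 1) = -2/9 in 𝔽_p, so the shifted
Legendre polynomial L of degree m solves the hypergeometric equation with parameters 1/3, 2/3; 1.
Two cubic changes of variable turn it into Heun solutions of degree less than p, (1 - 2x)^(p-1)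
L(27x²/(1 - 2x)³) and (1 + 4x)^(p-1) L(27x/(1 + 4x)³). Their constant terms agree, so they are the
same polynomial f (`cubicPullback_heun_and_eq`).

The involution x ↦ (1 - 8x)/(8(1 + x)) fixes t and exchanges the two cubic arguments up to s ↦ 1 -
s. Since L(1 - s) = (-1)^m L(s), f is an eigenvector of the involution with eigenvalue (-1)^m
(`isAtkinLehnerEigen_cubicPullback`).

With M = (p - 1)/2, such an f is (1 + x)^M B(t) if (-1)^m = (9/8)^M, and (1 - 16x - 8x²)(1 +
x)^(M-1) B(t) if the signs are opposite. Squaring gives B² or (t² - 34t + 1)B², because (1 - 16x -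
8x²)² = (1 + x)²(t² - 34t + 1). Finally (-1)^m depends on p mod 3, and (9/8)^M is the Legendre
symbol of 2, which depends on p mod 8. -/

/-! ### Legendre's differential equation -/

theorem shiftedLegendre_ode (n : ℕ) :
    X * (1 - X) * derivative (derivative (shiftedLegendre n)) +
      (1 - 2 * X) * derivative (shiftedLegendre n) +
      (n * (n + 1) : ℤ[X]) * shiftedLegendre n = 0 := by
  -- The equation is equivalent to this two-term recurrence on coefficients.
  have key : ∀ k : ℕ, ((k : ℤ) + 1) ^ 2 * (shiftedLegendre n).coeff (k + 1) =
      (k * (k + 1) - n * (n + 1)) * (shiftedLegendre n).coeff k := by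
    intro k
    simp only [coeff_shiftedLegendre]
    have h1 : ((n.choose (k + 1) : ℤ)) * (k + 1) = n.choose k * (n - k) := by
      rcases le_or_gt k n with h | h
      · have := Nat.choose_succ_right_eq n k
        zify [h] at this
        exact this
      · rw [Nat.choose_eq_zero_of_lt h, Nat.choose_eq_zero_of_lt (by omega)]; simp
    have h2 : (((n + (k + 1)).choose n : ℤ)) * (k + 1) = (n + k).choose n * (n + k + 1) := by
      have := Nat.add_one_mul_choose_eq (n + k) k
      rw [Nat.choose_symm_add, show n + (k + 1) = n + k + 1 by ring,
        show (n + k).choose n = (n + k).choose k from Nat.choose_symm_add]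
      zify at this
      linear_combination -this
    rw [pow_succ]
    linear_combination (-1) ^ (k + 1) * ((n + (k + 1)).choose n : ℤ) * (k + 1) * h1 +
      (-1) ^ (k + 1) * (n.choose k : ℤ) * (n - k) * h2
  have e : X * (1 - X) * derivative (derivative (shiftedLegendre n)) +
      (1 - 2 * X) * derivative (shiftedLegendre n) +
      (n * (n + 1) : ℤ[X]) * shiftedLegendre n =
      X * derivative (derivative (shiftedLegendre n)) -
      X * (X * derivative (derivative (shiftedLegendre n))) +
      derivative (shiftedLegendre n) - C 2 * (X * derivative (shiftedLegendre n)) +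
      C (n * (n + 1) : ℤ) * shiftedLegendre n := by
    simp only [C_mul, map_ofNat, C_add, map_natCast, map_one]; ring
  rw [e]
  ext k
  simp only [coeff_add, coeff_sub, coeff_C_mul, coeff_zero]
  rcases k with _ | _ | k
  · have := key 0
    simp [coeff_derivative] at this ⊢
    linarith
  · have := key 1
    simp [coeff_derivative, coeff_X_mul] at this ⊢
    linarith
  · have := key (k + 2)
    simp [coeff_derivative, coeff_X_mul] at this ⊢
    linarith

/-! ### The Apéry recurrence -/

/-- The square root of the summand of the Apéry numbers. -/
def aperyTerm (n k : ℕ) : ℚ := n.choose k * (n + k).choose n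

theorem aperyTerm_eq_div {n k : ℕ} (h : k ≤ n) :
    aperyTerm n k = (n + k).factorial / ((n - k).factorial * k.factorial ^ 2) := by
  have h1 := Nat.choose_mul_factorial_mul_factorial h
  have h2 := Nat.add_choose_mul_factorial_mul_factorial n k
  have a := Nat.factorial_ne_zero k
  have b := Nat.factorial_ne_zero (n - k)
  have c := Nat.factorial_ne_zero n
  rw [aperyTerm, eq_div_iff (by positivity)]
  have h1' : (n.choose k : ℚ) * k.factorial * (n - k).factorial = n.factorial := by
    exact_mod_cast h1
  have h2' : ((n + k).choose n : ℚ) * n.factorial * k.factorial = (n + k).factorial := by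
    rw [← h2]
    push_cast [Nat.choose_symm_add]
    rw [show (n + k).choose n = (n + k).choose k from Nat.choose_symm_add]
  linear_combination ((n + k).choose n : ℚ) * k.factorial * h1' + h2'

theorem aperyTerm_eq_zero {n k : ℕ} (h : n < k) : aperyTerm n k = 0 := by
  simp [aperyTerm, Nat.choose_eq_zero_of_lt h]

/-- All terms in the telescoping identity are polynomial multiples of one M = (n + k)!/((n + 2 - k)!
k!²), which reduces that identity to a polynomial one. The bound on k keeps n + 2 - k from
truncating. -/
theorem aperyTerm_common (n k : ℕ) (h : k ≤ n + 2) : ∃ M : ℚ,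
    aperyTerm n k = M * ((n + 1 - k) * (n + 2 - k)) ∧
    aperyTerm (n + 1) k = M * ((n + 1 + k) * (n + 2 - k)) ∧
    aperyTerm (n + 2) k = M * ((n + 1 + k) * (n + 2 + k)) ∧
    ∀ j, k = j + 1 → aperyTerm (n + 1) j = M * k ^ 2 := by
  have fz : ∀ a : ℕ, (a.factorial : ℚ) ≠ 0 := fun a => by
    exact_mod_cast Nat.factorial_ne_zero a
  refine ⟨(n + k).factorial / ((n + 2 - k).factorial * k.factorial ^ 2), ?_, ?_, ?_, ?_⟩
  · rcases le_or_gt k n with h' | h'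
    · obtain ⟨d, rfl⟩ := Nat.exists_eq_add_of_le h'
      rw [aperyTerm_eq_div h', show k + d - k = d by omega, show k + d + 2 - k = d + 1 + 1 by omega]
      simp only [Nat.factorial_succ]
      have := fz d; have := fz k
      push_cast
      field_simp
      ring
    · rw [aperyTerm_eq_zero h']
      have : k = n + 1 ∨ k = n + 2 := by omega
      rcases this with rfl | rfl <;> push_cast <;> ring
  · rcases le_or_gt k (n + 1) with h' | h'
    · obtain ⟨d, hd⟩ := Nat.exists_eq_add_of_le h'
      rw [aperyTerm_eq_div h', show n + 1 - k = d by omega, show n + 2 - k = d + 1 by omega,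
        show n + 1 + k = n + k + 1 by omega]
      have hd' : (n : ℚ) = k + d - 1 := by
        have : ((n + 1 : ℕ) : ℚ) = ((k + d : ℕ) : ℚ) := by rw [hd]
        push_cast at this; linarith
      simp only [Nat.factorial_succ]
      have := fz d; have := fz k; have := fz (n + k)
      push_cast
      rw [hd']
      field_simp
      ring
    · rw [aperyTerm_eq_zero h']
      have : k = n + 2 := by omega
      subst this; push_cast; ring
  · rw [aperyTerm_eq_div h, show n + 2 + k = n + k + 1 + 1 by omega]
    simp only [Nat.factorial_succ]
    have := fz (n + 2 - k); have := fz k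
    push_cast
    field_simp
    ring
  · rintro j rfl
    rw [aperyTerm_eq_div (by omega), show n + 1 - j = n + 2 - (j + 1) by omega,
      show n + 1 + j = n + (j + 1) by omega]
    simp only [Nat.factorial_succ]
    have := fz (n + 2 - (j + 1)); have := fz j
    push_cast
    field_simp

theorem aperyNumber_eq_sum {n K : ℕ} (h : n < K) :
    (aperyNumber n : ℚ) = ∑ k ∈ Finset.range K, aperyTerm n k ^ 2 := by
  rw [← Finset.sum_subset (Finset.range_subset_range.2 h)]
  · simp [aperyNumber, aperyTerm, mul_pow]
  · intro k _ hk
    rw [aperyTerm_eq_zero (by simpa using hk)]; simp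

theorem aperyNumber_recurrence (n : ℕ) :
    ((n : ℤ) + 2) ^ 3 * aperyNumber (n + 2) + (n + 1) ^ 3 * aperyNumber n =
      (34 * (n + 1) ^ 3 + 51 * (n + 1) ^ 2 + 27 * (n + 1) + 5) * aperyNumber (n + 1) := by
  have key : ((n : ℚ) + 2) ^ 3 * aperyNumber (n + 2) + (n + 1) ^ 3 * aperyNumber n -
      (34 * (n + 1) ^ 3 + 51 * (n + 1) ^ 2 + 27 * (n + 1) + 5) * aperyNumber (n + 1) = 0 := by
    rw [aperyNumber_eq_sum (show n + 2 < n + 3 by omega),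
      aperyNumber_eq_sum (show n + 1 < n + 3 by omega), aperyNumber_eq_sum (show n < n + 3 by omega),
      Finset.mul_sum, Finset.mul_sum, Finset.mul_sum, ← Finset.sum_add_distrib,
      ← Finset.sum_sub_distrib]
    -- Zeilberger's certificate for the Apéry sum, with indices shifted. The default 0 at k = 0
    -- stands for the term of index -1, so the telescoped sum vanishes at both ends.
    let G : ℕ → ℚ := fun k => 4 * (2 * n + 3) * ((k - 1) * (2 * k - 1) - (2 * n + 3) ^ 2) *
      (if k = 0 then 0 else aperyTerm (n + 1) (k - 1)) ^ 2
    have step : ∀ k ∈ Finset.range (n + 3),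
        ((n : ℚ) + 2) ^ 3 * aperyTerm (n + 2) k ^ 2 + (n + 1) ^ 3 * aperyTerm n k ^ 2 -
        (34 * (n + 1) ^ 3 + 51 * (n + 1) ^ 2 + 27 * (n + 1) + 5) * aperyTerm (n + 1) k ^ 2 =
        G (k + 1) - G k := by
      intro k hk
      obtain ⟨M, h0, h1, h2, h3⟩ := aperyTerm_common n k (by simp at hk; omega)
      have h4 : (if k = 0 then 0 else aperyTerm (n + 1) (k - 1)) = M * k ^ 2 := by
        rcases k with _ | j
        · simp
        · simp [h3 j rfl]
      simp only [G, h4, Nat.add_eq_zero_iff, one_ne_zero, and_false, if_false,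
        Nat.add_sub_cancel]
      rw [h0, h1, h2]
      push_cast
      ring
    rw [Finset.sum_congr rfl step, Finset.sum_range_sub]
    simp [G, aperyTerm_eq_zero (show n + 1 < n + 2 by omega)]
  have : ((n : ℚ) + 2) ^ 3 * aperyNumber (n + 2) + (n + 1) ^ 3 * aperyNumber n =
      (34 * (n + 1) ^ 3 + 51 * (n + 1) ^ 2 + 27 * (n + 1) + 5) * aperyNumber (n + 1) := by
    linarith
  exact_mod_cast this

/-! ### Uniqueness of polynomial solutions modulo p -/

theorem CharP.natCast_ne_zero_of_pos_of_lt {K : Type*} [Field K] (p : ℕ) [CharP K p] {n : ℕ}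
    (h0 : 0 < n) (h : n < p) : (n : K) ≠ 0 := fun hn =>
  Nat.not_dvd_of_pos_of_lt h0 h ((CharP.cast_eq_zero_iff K p n).1 hn)

theorem heun_recurrence {K : Type*} [Field K] {u : K[X]}
    (h : X * (1 - 8 * X) * (1 + X) * derivative (derivative u) +
      (1 - 14 * X - 24 * X ^ 2) * derivative u - (2 + 8 * X) * u = 0) :
    u.coeff 1 = 2 * u.coeff 0 ∧ ∀ n : ℕ, ((n : K) + 2) ^ 2 * u.coeff (n + 2) =
      (7 * (n + 1) ^ 2 + 7 * (n + 1) + 2) * u.coeff (n + 1) + 8 * (n + 1) ^ 2 * u.coeff n := by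
  -- Nested factors X let coefficient extraction shift one index at a time; the lowest coefficients
  -- are treated separately.
  have e : X * derivative (derivative u) - C 7 * (X * (X * derivative (derivative u))) -
      C 8 * (X * (X * (X * derivative (derivative u)))) + derivative u -
      C 14 * (X * derivative u) - C 24 * (X * (X * derivative u)) - C 2 * u - C 8 * (X * u) = 0 := by
    rw [← h]; simp only [map_ofNat]; ring
  have h0 := congrArg (coeff · 0) e
  simp [coeff_derivative] at h0
  refine ⟨by linear_combination h0, ?_⟩
  rintro (_ | _ | n)
  · have h1 := congrArg (coeff · 1) e
    simp [coeff_derivative, coeff_X_mul] at h1 ⊢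
    linear_combination h1
  · have h1 := congrArg (coeff · 2) e
    simp [coeff_derivative, coeff_X_mul] at h1 ⊢
    linear_combination h1
  · have h1 := congrArg (coeff · (n + 3)) e
    simp [coeff_derivative, coeff_X_mul] at h1 ⊢
    linear_combination h1

/-- The leading factor (n + 2)² of the recurrence is invertible as long as n + 2 < p. -/
theorem heun_unique {K : Type*} [Field K] (p : ℕ) [CharP K p] {u : K[X]} (hdeg : u.natDegree < p)
    (h : X * (1 - 8 * X) * (1 + X) * derivative (derivative u) +
      (1 - 14 * X - 24 * X ^ 2) * derivative u - (2 + 8 * X) * u = 0)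
    (h0 : u.coeff 0 = 0) : u = 0 := by
  obtain ⟨h1, h2⟩ := heun_recurrence h
  have key : ∀ n, n < p → u.coeff n = 0 := by
    intro n
    induction n using Nat.strong_induction_on with
    | _ n ih =>
      intro hn
      rcases n with _ | _ | n
      · exact h0
      · simp [h1, h0]
      · have := h2 n
        rw [ih (n + 1) (by omega) (by omega), ih n (by omega) (by omega)] at this
        have hne := CharP.natCast_ne_zero_of_pos_of_lt (K := K) p (n := n + 2) (by omega) hn
        push_cast at hne
        simpa [hne] using this
  ext n
  rcases lt_or_ge n p with hn | hn
  · simp [key n hn]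
  · simp [coeff_eq_zero_of_natDegree_lt (hdeg.trans_le hn)]

theorem apery_ode_recurrence {K : Type*} [Field K] {u : K[X]}
    (h : X ^ 2 * (X ^ 2 - 34 * X + 1) * derivative (derivative (derivative u)) +
      (6 * X ^ 3 - 153 * X ^ 2 + 3 * X) * derivative (derivative u) +
      (7 * X ^ 2 - 112 * X + 1) * derivative u + (X - 5) * u = 0) :
    u.coeff 1 = 5 * u.coeff 0 ∧ ∀ n : ℕ, ((n : K) + 2) ^ 3 * u.coeff (n + 2) +
      (n + 1) ^ 3 * u.coeff n =
      (34 * (n + 1) ^ 3 + 51 * (n + 1) ^ 2 + 27 * (n + 1) + 5) * u.coeff (n + 1) := by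
  have e : X * (X * (X * (X * derivative (derivative (derivative u))))) -
      C 34 * (X * (X * (X * derivative (derivative (derivative u))))) +
      X * (X * derivative (derivative (derivative u))) +
      C 6 * (X * (X * (X * derivative (derivative u)))) -
      C 153 * (X * (X * derivative (derivative u))) +
      C 3 * (X * derivative (derivative u)) +
      C 7 * (X * (X * derivative u)) - C 112 * (X * derivative u) + derivative u +
      X * u - C 5 * u = 0 := by
    rw [← h]; simp only [map_ofNat]; ring
  have h0 := congrArg (coeff · 0) e
  simp [coeff_derivative] at h0
  refine ⟨by linear_combination h0, ?_⟩
  rintro (_ | _ | _ | n)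
  · have h1 := congrArg (coeff · 1) e
    simp [coeff_derivative, coeff_X_mul] at h1 ⊢
    linear_combination h1
  · have h1 := congrArg (coeff · 2) e
    simp [coeff_derivative, coeff_X_mul] at h1 ⊢
    linear_combination h1
  · have h1 := congrArg (coeff · 3) e
    simp [coeff_derivative, coeff_X_mul] at h1 ⊢
    linear_combination h1
  · have h1 := congrArg (coeff · (n + 4)) e
    simp [coeff_derivative, coeff_X_mul] at h1 ⊢
    linear_combination h1

theorem coeff_aperyTrunc (p n : ℕ) :
    (aperyTrunc p).coeff n = if n < p then (aperyNumber n : ZMod p) else 0 := by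
  simp [aperyTrunc, aperySeries, PowerSeries.coeff_trunc]

/-- A polynomial of degree less than `p` with constant term `1` satisfying the Apéry
differential equation modulo `p` is the truncated Apéry series. -/
theorem eq_aperyTrunc_of_ode {p : ℕ} [Fact p.Prime] {u : (ZMod p)[X]} (hdeg : u.natDegree < p)
    (h : X ^ 2 * (X ^ 2 - 34 * X + 1) * derivative (derivative (derivative u)) +
      (6 * X ^ 3 - 153 * X ^ 2 + 3 * X) * derivative (derivative u) +
      (7 * X ^ 2 - 112 * X + 1) * derivative u + (X - 5) * u = 0)
    (h0 : u.coeff 0 = 1) : aperyTrunc p = u := by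
  obtain ⟨h1, h2⟩ := apery_ode_recurrence h
  have key : ∀ n, n < p → u.coeff n = aperyNumber n := by
    intro n
    induction n using Nat.strong_induction_on with
    | _ n ih =>
      intro hn
      rcases n with _ | _ | n
      · simp [h0, aperyNumber]
      · simp [h1, h0, aperyNumber, Finset.sum_range_succ]
      · have := h2 n
        rw [ih (n + 1) (by omega) (by omega), ih n (by omega) (by omega)] at this
        have hne := CharP.natCast_ne_zero_of_pos_of_lt (K := ZMod p) p (n := n + 2) (by omega) hn
        push_cast at hne
        have hr := congrArg (Int.cast : ℤ → ZMod p) (aperyNumber_recurrence n)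
        push_cast at hr
        exact mul_left_cancel₀ (pow_ne_zero 3 hne) (by linear_combination this - hr)
  ext n
  rw [coeff_aperyTrunc]
  split_ifs with hn
  · exact (key n hn).symm
  · exact (coeff_eq_zero_of_natDegree_lt (by omega)).symm

/-! ### Algebraic identities behind the pullbacks -/

/-- Here a, b, c stand for L, L', L'' at s = 27x²v³, and the conclusion is the Heun operator on v
L(s), expanded by the chain rule. It equals 12x(1 + x)v³ times the hypergeometric operator at s. -/
theorem legendre_pullback_identity_two {K : Type*} [Field K] {x v a b c : K}
    (hv : v * (1 - 2 * x) = 1)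
    (h : 9 * (27 * x ^ 2 * v ^ 3 * (1 - 27 * x ^ 2 * v ^ 3) * c +
      (1 - 2 * (27 * x ^ 2 * v ^ 3)) * b) - 2 * a = 0) :
    x * (1 - 8 * x) * (1 + x) * (8 * v ^ 3 * a + 4 * v ^ 2 * b * (54 * x * v ^ 3 + 162 * x ^ 2 * v ^ 4)
      + v * c * (54 * x * v ^ 3 + 162 * x ^ 2 * v ^ 4) ^ 2
      + v * b * (54 * v ^ 3 + 648 * x * v ^ 4 + 1296 * x ^ 2 * v ^ 5)) +
    (1 - 14 * x - 24 * x ^ 2) * (2 * v ^ 2 * a + v * b * (54 * x * v ^ 3 + 162 * x ^ 2 * v ^ 4)) -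
    (2 + 8 * x) * (v * a) = 0 := by
  have hq : 1 - 2 * x ≠ 0 := right_ne_zero_of_mul_eq_one hv
  obtain ⟨q, hqx⟩ : ∃ q, q = 1 - 2 * x := ⟨_, rfl⟩
  rw [← hqx] at hv hq
  obtain rfl : v = 1 / q := eq_div_of_mul_eq hq hv
  linear_combination (norm := skip) (12 * x * (1 + x) * (1 / q) ^ 3) * h
  field_simp
  rw [hqx]
  ring

/-- The same for s = 27xv³, with factor 3(1 - 8x)v³. -/
theorem legendre_pullback_identity_four {K : Type*} [Field K] {x v a b c : K}
    (hv : v * (1 + 4 * x) = 1)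
    (h : 9 * (27 * x * v ^ 3 * (1 - 27 * x * v ^ 3) * c +
      (1 - 2 * (27 * x * v ^ 3)) * b) - 2 * a = 0) :
    x * (1 - 8 * x) * (1 + x) * (32 * v ^ 3 * a - 8 * v ^ 2 * b * (27 * v ^ 3 - 324 * x * v ^ 4)
      + v * c * (27 * v ^ 3 - 324 * x * v ^ 4) ^ 2
      + v * b * (5184 * x * v ^ 5 - 648 * v ^ 4)) +
    (1 - 14 * x - 24 * x ^ 2) * (v * b * (27 * v ^ 3 - 324 * x * v ^ 4) - 4 * v ^ 2 * a) -
    (2 + 8 * x) * (v * a) = 0 := by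
  have hq : 1 + 4 * x ≠ 0 := right_ne_zero_of_mul_eq_one hv
  obtain ⟨q, hqx⟩ : ∃ q, q = 1 + 4 * x := ⟨_, rfl⟩
  rw [← hqx] at hv hq
  obtain rfl : v = 1 / q := eq_div_of_mul_eq hq hv
  linear_combination (norm := skip) (3 * (1 - 8 * x) * (1 / q) ^ 3) * h
  field_simp
  rw [hqx]
  ring

/-- The change of variable `t = x (1 - 8 x) / (1 + x)` turns the symmetric square of the Heun
equation into the Apéry equation. -/
theorem apery_pullback_identity {K : Type*} [Field K]
    {x v t t₁ t₂ t₃ f f₁ f₂ f₃ k c₀ c₁ c₂ c₃ : K}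
    (hv : v * (1 + x) = 1) (hx : x ≠ 0) (hx8 : 1 - 8 * x ≠ 0)
    (hT : 1 - 16 * x - 8 * x ^ 2 ≠ 0) (hk : k ≠ 0)
    (ht : t = x * (1 - 8 * x) * v) (ht₁ : t₁ = (1 - 16 * x - 8 * x ^ 2) * v ^ 2)
    (ht₂ : t₂ = -18 * v ^ 3) (ht₃ : t₃ = 54 * v ^ 4)
    (h2 : x * (1 - 8 * x) * (1 + x) * f₂ + (1 - 14 * x - 24 * x ^ 2) * f₁ - (2 + 8 * x) * f = 0)
    (h3 : x * (1 - 8 * x) * (1 + x) * f₃ + 2 * (1 - 14 * x - 24 * x ^ 2) * f₂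
      - (16 + 56 * x) * f₁ - 8 * f = 0)
    (e0 : k * c₀ = (1 + x) * f ^ 2) (e1 : k * (c₁ * t₁) = f ^ 2 + 2 * (1 + x) * f * f₁)
    (e2 : k * (c₂ * t₁ ^ 2 + c₁ * t₂) = 4 * f * f₁ + 2 * (1 + x) * (f₁ ^ 2 + f * f₂))
    (e3 : k * (c₃ * t₁ ^ 3 + 3 * c₂ * t₁ * t₂ + c₁ * t₃) =
      6 * (f₁ ^ 2 + f * f₂) + 2 * (1 + x) * (3 * f₁ * f₂ + f * f₃)) :
    t ^ 2 * (t ^ 2 - 34 * t + 1) * c₃ + (6 * t ^ 3 - 153 * t ^ 2 + 3 * t) * c₂ +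
      (7 * t ^ 2 - 112 * t + 1) * c₁ + (t - 5) * c₀ = 0 := by
  have hq : 1 + x ≠ 0 := right_ne_zero_of_mul_eq_one hv
  obtain ⟨q, hqx⟩ : ∃ q, q = 1 + x := ⟨_, rfl⟩
  obtain ⟨r, hrx⟩ : ∃ r, r = 1 - 8 * x := ⟨_, rfl⟩
  rw [← hqx] at hv hq e0 e1 e2 e3 h2 h3
  rw [← hrx] at hx8 h2 h3 ht
  obtain rfl : v = 1 / q := eq_div_of_mul_eq hq hv
  have ht₁0 : t₁ ≠ 0 := by
    rw [ht₁]; exact mul_ne_zero hT (pow_ne_zero 2 (one_div_ne_zero hq))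
  have hxrq : x * r * q ≠ 0 := mul_ne_zero (mul_ne_zero hx hx8) hq
  obtain rfl : f₂ = ((2 + 8 * x) * f - (1 - 14 * x - 24 * x ^ 2) * f₁) / (x * r * q) := by
    rw [eq_div_iff hxrq]; linear_combination h2
  obtain rfl : f₃ = (8 * f + (16 + 56 * x) * f₁ - 2 * (1 - 14 * x - 24 * x ^ 2) *
      (((2 + 8 * x) * f - (1 - 14 * x - 24 * x ^ 2) * f₁) / (x * r * q))) / (x * r * q) := by
    rw [eq_div_iff hxrq]; linear_combination h3
  clear h2 h3
  apply mul_left_cancel₀ (mul_ne_zero hk (pow_ne_zero 5 ht₁0))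
  -- Solving the triangular system `e1`, `e2`, `e3` for c₁, c₂, c₃ produces the denominator t₁⁵.
  have E : k * t₁ ^ 5 * (t ^ 2 * (t ^ 2 - 34 * t + 1) * c₃ + (6 * t ^ 3 - 153 * t ^ 2 + 3 * t) * c₂ +
      (7 * t ^ 2 - 112 * t + 1) * c₁ + (t - 5) * c₀) =
      t ^ 2 * (t ^ 2 - 34 * t + 1) * (t₁ ^ 2 * (k * (c₃ * t₁ ^ 3 + 3 * c₂ * t₁ * t₂ + c₁ * t₃))
        - 3 * t₁ * t₂ * (k * (c₂ * t₁ ^ 2 + c₁ * t₂)) + (3 * t₂ ^ 2 - t₁ * t₃) * (k * (c₁ * t₁))) +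
      (6 * t ^ 3 - 153 * t ^ 2 + 3 * t) * (t₁ ^ 3 * (k * (c₂ * t₁ ^ 2 + c₁ * t₂)) -
        t₁ ^ 2 * t₂ * (k * (c₁ * t₁))) +
      (7 * t ^ 2 - 112 * t + 1) * t₁ ^ 4 * (k * (c₁ * t₁)) + (t - 5) * t₁ ^ 5 * (k * c₀) := by ring
  rw [E, e0, e1, e2, e3, ht, ht₁, ht₂, ht₃]
  field_simp
  rw [hqx, hrx]
  ring

/-! ### Cubic pullbacks and the Heun equation -/

/-- The polynomial `q ^ n * L (r / q ^ 3)`, for `n ≥ 3 * L.natDegree`. -/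
noncomputable def cubicPullback {F : Type*} [Field F] (L : F[X]) (n : ℕ) (q r : F[X]) : F[X] :=
  ∑ k ∈ Finset.range (L.natDegree + 1), C (L.coeff k) * r ^ k * q ^ (n - 3 * k)

section cubicPullback
variable {F : Type*} [Field F]

theorem aeval_cubicPullback {A : Type*} [CommRing A] [Algebra F A] {L : F[X]} {n : ℕ}
    (hn : 3 * L.natDegree ≤ n) (q r : F[X]) {y v : A} (hv : v * aeval y q = 1) :
    aeval y (cubicPullback L n q r) =
      aeval y q ^ n * aeval (aeval y r * v ^ 3) L := by
  rw [cubicPullback, map_sum, aeval_eq_sum_range (p := L), Finset.mul_sum]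
  refine Finset.sum_congr rfl fun k hk => ?_
  have hk' : 3 * k ≤ n := by
    have := Finset.mem_range.1 hk
    omega
  simp only [map_mul, map_pow, aeval_C, Algebra.smul_def]
  have h1 : aeval y q ^ n * v ^ (3 * k) = aeval y q ^ (n - 3 * k) := by
    conv_lhs => rw [← Nat.sub_add_cancel hk', pow_add, mul_assoc, ← mul_pow, mul_comm _ v, hv]
    simp
  rw [mul_pow, ← pow_mul, ← h1]
  ring

theorem natDegree_cubicPullback_le {L : F[X]} {n : ℕ} (hn : 3 * L.natDegree ≤ n) {q r : F[X]}
    (hq : q.natDegree ≤ 1) (hr : r.natDegree ≤ 2) : (cubicPullback L n q r).natDegree ≤ n := by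
  refine natDegree_sum_le_of_forall_le _ _ fun k hk => ?_
  have hk' : 3 * k ≤ n := by
    have := Finset.mem_range.1 hk
    omega
  have h1 := natDegree_mul_le (p := C (L.coeff k) * r ^ k) (q := q ^ (n - 3 * k))
  have h2 := natDegree_C_mul_le (L.coeff k) (r ^ k)
  have h3 := natDegree_pow_le_of_le k hr
  have h4 := natDegree_pow_le_of_le (n - 3 * k) hq
  omega

theorem coeff_zero_cubicPullback (L : F[X]) (n : ℕ) {q r : F[X]} (hq : q.coeff 0 = 1)
    (hr : r.coeff 0 = 0) : (cubicPullback L n q r).coeff 0 = L.coeff 0 := by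
  rw [cubicPullback, coeff_zero_eq_eval_zero, eval_finsetSum, Finset.sum_range_succ']
  simp [← coeff_zero_eq_eval_zero, hq, hr]

end cubicPullback

section Derivation
variable {F A : Type*} [Field F] [CommRing A] [Algebra F A] (D : Derivation F A A)

theorem Derivation.map_ofNat (n : ℕ) [n.AtLeastTwo] : D (OfNat.ofNat n : A) = 0 := by
  rw [← Nat.cast_ofNat (R := A), D.map_natCast]

theorem Derivation.map_ofNat_mul (n : ℕ) [n.AtLeastTwo] (a : A) :
    D (OfNat.ofNat n * a) = OfNat.ofNat n * D a := by
  rw [D.leibniz, D.map_ofNat]; simp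

/-- In characteristic p a p-th power is a constant for D. This lets q^(p-1) replace 1/q in solutions
of linear differential equations. -/
theorem Derivation.map_pow_char_mul (p : ℕ) [CharP A p] (q w : A) : D (q ^ p * w) = q ^ p * D w := by
  simp [D.leibniz, D.leibniz_pow, ← Nat.cast_smul_eq_nsmul A]

end Derivation

section Heun
variable {F A : Type*} [Field F] [CommRing A] [IsDomain A] [Algebra F A]
  (D : Derivation F A A) {x v : A}

theorem legendre_pullback_two (hx : D x = 1) (hv : v * (1 - 2 * x) = 1) {L : F[X]}
    (hL : ∀ s : A, 9 * (s * (1 - s) * aeval s (derivative (derivative L)) +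
      (1 - 2 * s) * aeval s (derivative L)) - 2 * aeval s L = 0) :
    x * (1 - 8 * x) * (1 + x) * D (D (v * aeval (27 * x ^ 2 * v ^ 3) L)) +
      (1 - 14 * x - 24 * x ^ 2) * D (v * aeval (27 * x ^ 2 * v ^ 3) L) -
      (2 + 8 * x) * (v * aeval (27 * x ^ 2 * v ^ 3) L) = 0 := by
  have hDv : D v = 2 * v ^ 2 := by
    have h := congrArg D hv
    rw [D.leibniz, map_sub, D.map_ofNat_mul, D.map_one_eq_zero, hx, smul_eq_mul, smul_eq_mul] at h
    linear_combination v * h - D v * hv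
  have hDs : D (27 * x ^ 2 * v ^ 3) = 54 * x * v ^ 3 + 162 * x ^ 2 * v ^ 4 := by
    rw [mul_assoc, D.map_ofNat_mul]
    simp only [D.leibniz, D.leibniz_pow, smul_eq_mul, nsmul_eq_mul, hx, hDv]
    push_cast
    ring
  have hDs' : D (54 * x * v ^ 3 + 162 * x ^ 2 * v ^ 4) =
      54 * v ^ 3 + 648 * x * v ^ 4 + 1296 * x ^ 2 * v ^ 5 := by
    rw [map_add, mul_assoc, mul_assoc, D.map_ofNat_mul, D.map_ofNat_mul]
    simp only [D.leibniz, D.leibniz_pow, smul_eq_mul, nsmul_eq_mul, hx, hDv]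
    push_cast
    ring
  have h1 : D (v * aeval (27 * x ^ 2 * v ^ 3) L) = 2 * v ^ 2 * aeval (27 * x ^ 2 * v ^ 3) L +
      v * aeval (27 * x ^ 2 * v ^ 3) (derivative L) * (54 * x * v ^ 3 + 162 * x ^ 2 * v ^ 4) := by
    rw [D.leibniz, D.map_aeval, hDs, hDv]
    simp only [smul_eq_mul]
    ring
  have h2 : D (D (v * aeval (27 * x ^ 2 * v ^ 3) L)) =
      8 * v ^ 3 * aeval (27 * x ^ 2 * v ^ 3) L +
      4 * v ^ 2 * aeval (27 * x ^ 2 * v ^ 3) (derivative L) *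
        (54 * x * v ^ 3 + 162 * x ^ 2 * v ^ 4) +
      v * aeval (27 * x ^ 2 * v ^ 3) (derivative (derivative L)) *
        (54 * x * v ^ 3 + 162 * x ^ 2 * v ^ 4) ^ 2 +
      v * aeval (27 * x ^ 2 * v ^ 3) (derivative L) *
        (54 * v ^ 3 + 648 * x * v ^ 4 + 1296 * x ^ 2 * v ^ 5) := by
    rw [h1, map_add, mul_assoc 2, D.map_ofNat_mul, D.leibniz (v ^ 2), D.leibniz (v * _),
      D.leibniz v, D.map_aeval, D.map_aeval, hDs', hDs, D.leibniz_pow, hDv]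
    simp only [smul_eq_mul, nsmul_eq_mul]
    push_cast
    ring
  rw [h2, h1]
  apply IsFractionRing.injective A (FractionRing A)
  have h3 := congrArg (algebraMap A (FractionRing A)) hv
  have h4 := congrArg (algebraMap A (FractionRing A)) (hL (27 * x ^ 2 * v ^ 3))
  simp only [map_add, map_sub, map_mul, map_pow, map_one, map_zero, map_ofNat] at h3 h4 ⊢
  exact legendre_pullback_identity_two h3 h4

theorem legendre_pullback_four (hx : D x = 1) (hv : v * (1 + 4 * x) = 1) {L : F[X]}
    (hL : ∀ s : A, 9 * (s * (1 - s) * aeval s (derivative (derivative L)) +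
      (1 - 2 * s) * aeval s (derivative L)) - 2 * aeval s L = 0) :
    x * (1 - 8 * x) * (1 + x) * D (D (v * aeval (27 * x * v ^ 3) L)) +
      (1 - 14 * x - 24 * x ^ 2) * D (v * aeval (27 * x * v ^ 3) L) -
      (2 + 8 * x) * (v * aeval (27 * x * v ^ 3) L) = 0 := by
  have hDv : D v = -(4 * v ^ 2) := by
    have h := congrArg D hv
    rw [D.leibniz, map_add, D.map_ofNat_mul, D.map_one_eq_zero, hx, smul_eq_mul, smul_eq_mul] at h
    linear_combination v * h - D v * hv
  have hDs : D (27 * x * v ^ 3) = 27 * v ^ 3 - 324 * x * v ^ 4 := by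
    rw [mul_assoc, D.map_ofNat_mul]
    simp only [D.leibniz, D.leibniz_pow, smul_eq_mul, nsmul_eq_mul, hx, hDv]
    push_cast
    ring
  have hDs' : D (27 * v ^ 3 - 324 * x * v ^ 4) = 5184 * x * v ^ 5 - 648 * v ^ 4 := by
    rw [map_sub, mul_assoc 324, D.map_ofNat_mul, D.map_ofNat_mul]
    simp only [D.leibniz, D.leibniz_pow, smul_eq_mul, nsmul_eq_mul, hx, hDv]
    push_cast
    ring
  have h1 : D (v * aeval (27 * x * v ^ 3) L) =
      v * aeval (27 * x * v ^ 3) (derivative L) * (27 * v ^ 3 - 324 * x * v ^ 4) -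
      4 * v ^ 2 * aeval (27 * x * v ^ 3) L := by
    rw [D.leibniz, D.map_aeval, hDs, hDv]
    simp only [smul_eq_mul]
    ring
  have h2 : D (D (v * aeval (27 * x * v ^ 3) L)) =
      32 * v ^ 3 * aeval (27 * x * v ^ 3) L -
      8 * v ^ 2 * aeval (27 * x * v ^ 3) (derivative L) * (27 * v ^ 3 - 324 * x * v ^ 4) +
      v * aeval (27 * x * v ^ 3) (derivative (derivative L)) *
        (27 * v ^ 3 - 324 * x * v ^ 4) ^ 2 +
      v * aeval (27 * x * v ^ 3) (derivative L) * (5184 * x * v ^ 5 - 648 * v ^ 4) := by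
    rw [h1, map_sub, mul_assoc 4, D.map_ofNat_mul, D.leibniz (v ^ 2), D.leibniz (v * _),
      D.leibniz v, D.map_aeval, D.map_aeval, hDs', hDs, D.leibniz_pow, hDv]
    simp only [smul_eq_mul, nsmul_eq_mul]
    push_cast
    ring
  rw [h2, h1]
  apply IsFractionRing.injective A (FractionRing A)
  have h3 := congrArg (algebraMap A (FractionRing A)) hv
  have h4 := congrArg (algebraMap A (FractionRing A)) (hL (27 * x * v ^ 3))
  simp only [map_add, map_sub, map_mul, map_pow, map_one, map_zero, map_ofNat] at h3 h4 ⊢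
  exact legendre_pullback_identity_four h3 h4

end Heun

section Uniqueness
variable {F : Type*} [Field F] (p : ℕ) [CharP F p]

theorem aeval_powerSeries_X (P : F[X]) : aeval (PowerSeries.X : PowerSeries F) P = P := by
  induction P using Polynomial.induction_on' with
  | add p q hp hq => simp [hp, hq]
  | monomial n a =>
    simp [aeval_monomial, PowerSeries.monomial_eq_C_mul_X_pow]

instance PowerSeries.charP : CharP (PowerSeries F) p :=
  charP_of_injective_algebraMap (algebraMap F (PowerSeries F)).injective p

/-- Two polynomials `q ^ (p - 1) * L (r / q ^ 3)` of degree less than `p` both satisfy the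
Heun equation, and therefore coincide. -/
theorem cubicPullback_heun_and_eq [Fact p.Prime] {L : F[X]} (hdeg : 3 * L.natDegree ≤ p - 1)
    (hL : ∀ s : PowerSeries F, 9 * (s * (1 - s) * aeval s (derivative (derivative L)) +
      (1 - 2 * s) * aeval s (derivative L)) - 2 * aeval s L = 0) :
    (X * (1 - 8 * X) * (1 + X) *
        derivative (derivative (cubicPullback L (p - 1) (1 - 2 * X) (27 * X ^ 2))) +
      (1 - 14 * X - 24 * X ^ 2) * derivative (cubicPullback L (p - 1) (1 - 2 * X) (27 * X ^ 2)) -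
      (2 + 8 * X) * cubicPullback L (p - 1) (1 - 2 * X) (27 * X ^ 2) = 0) ∧
    cubicPullback L (p - 1) (1 - 2 * X) (27 * X ^ 2) =
      cubicPullback L (p - 1) (1 + 4 * X) (27 * X) := by
  have hp := (Fact.out : p.Prime).pos
  let D := PowerSeries.derivative F
  let x : PowerSeries F := PowerSeries.X
  have hx : D x = 1 := PowerSeries.derivative_X
  have hD : ∀ P : F[X], D (aeval x P) = aeval x (derivative P) := fun P => by
    rw [D.map_aeval, hx]; simp
  -- Since q^p is a constant for D, a power series solution w gives the solution q^p w, which is a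
  -- polynomial here.
  have ode : ∀ (g : F[X]) (q w : PowerSeries F), aeval x g = q ^ p * w →
      x * (1 - 8 * x) * (1 + x) * D (D w) + (1 - 14 * x - 24 * x ^ 2) * D w -
        (2 + 8 * x) * w = 0 →
      X * (1 - 8 * X) * (1 + X) * derivative (derivative g) +
        (1 - 14 * X - 24 * X ^ 2) * derivative g - (2 + 8 * X) * g = 0 := by
    intro g q w hg hw
    apply Polynomial.coe_injective
    rw [← aeval_powerSeries_X, ← aeval_powerSeries_X]
    change aeval x _ = aeval x _
    simp only [map_add, map_sub, map_mul, map_pow, map_one, map_zero, map_ofNat, aeval_X, ← hD, hg,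
      D.map_pow_char_mul p]
    linear_combination q ^ p * hw
  have pull : ∀ (q r : F[X]) (v : PowerSeries F), v * aeval x q = 1 →
      aeval x (cubicPullback L (p - 1) q r) =
        aeval x q ^ p * (v * aeval (aeval x r * v ^ 3) L) := by
    intro q r v hv
    rw [aeval_cubicPullback hdeg q r hv]
    conv_rhs => rw [← Nat.sub_add_cancel hp, pow_succ]
    linear_combination -aeval x q ^ (p - 1) * aeval (aeval x r * v ^ 3) L * hv
  have h1 : (1 - 2 * x)⁻¹ * aeval x (1 - 2 * X : F[X]) = 1 := by
    simp only [map_sub, map_mul, map_one, map_ofNat, aeval_X]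
    exact PowerSeries.inv_mul_cancel _ (by simp [x])
  have h2 : (1 + 4 * x)⁻¹ * aeval x (1 + 4 * X : F[X]) = 1 := by
    simp only [map_add, map_mul, map_one, map_ofNat, aeval_X]
    exact PowerSeries.inv_mul_cancel _ (by simp [x])
  have e1 := ode _ _ _ (pull _ (27 * X ^ 2) _ h1) (by
    simp only [map_sub, map_mul, map_pow, map_one, map_ofNat, aeval_X] at h1 ⊢
    exact legendre_pullback_two D hx h1 hL)
  have e2 := ode _ _ _ (pull _ (27 * X) _ h2) (by
    simp only [map_add, map_mul, map_one, map_ofNat, aeval_X] at h2 ⊢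
    exact legendre_pullback_four D hx h2 hL)
  refine ⟨e1, ?_⟩
  rw [← sub_eq_zero]
  refine heun_unique p ?_ ?_ ?_
  · refine lt_of_le_of_lt (natDegree_sub_le_of_le
      (natDegree_cubicPullback_le hdeg ?_ ?_) (natDegree_cubicPullback_le hdeg ?_ ?_))
      (show max (p - 1) (p - 1) < p by rw [max_self]; omega) <;> compute_degree!
  · simp only [map_sub]
    linear_combination e1 - e2
  · rw [coeff_sub, coeff_zero_cubicPullback _ _ (by simp) (by simp),
      coeff_zero_cubicPullback _ _ (by simp) (by simp), sub_self]

end Uniqueness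

/-! ### Eigenvectors of the involution -/

section Descent
variable (F : Type*) [Field F]

/-- The power series `(1 - 8 x) / (8 (1 + x))`, the Atkin–Lehner involution of the Heun equation. -/
noncomputable def atkinLehner : PowerSeries F :=
  PowerSeries.C 8⁻¹ * (1 - 8 * PowerSeries.X) * (1 + PowerSeries.X)⁻¹

/-- The power series `x (1 - 8 x) / (1 + x)`, invariant under the Atkin–Lehner involution. -/
noncomputable def aperyParam : PowerSeries F :=
  PowerSeries.X * (1 - 8 * PowerSeries.X) * (1 + PowerSeries.X)⁻¹

theorem one_add_X_inv_mul : (1 + PowerSeries.X : PowerSeries F)⁻¹ * (1 + PowerSeries.X) = 1 :=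
  PowerSeries.inv_mul_cancel _ (by simp)

variable {F}

/-- `f` is an eigenvector, with eigenvalue `c`, of the involution acting on polynomials of degree
at most `2 * N`. -/
def IsAtkinLehnerEigen (N : ℕ) (c : F) (f : F[X]) : Prop :=
  aeval (atkinLehner F) f * (1 + PowerSeries.X) ^ (2 * N) =
    PowerSeries.C c * aeval PowerSeries.X f

namespace IsAtkinLehnerEigen

theorem sub {N : ℕ} {c : F} {f g : F[X]} (hf : IsAtkinLehnerEigen N c f)
    (hg : IsAtkinLehnerEigen N c g) : IsAtkinLehnerEigen N c (f - g) := by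
  unfold IsAtkinLehnerEigen at *
  rw [map_sub, map_sub]
  linear_combination hf - hg

theorem C_mul {N : ℕ} {c : F} {f : F[X]} (hf : IsAtkinLehnerEigen N c f) (a : F) :
    IsAtkinLehnerEigen N c (C a * f) := by
  unfold IsAtkinLehnerEigen at *
  rw [map_mul, map_mul, aeval_C, aeval_C]
  linear_combination algebraMap F (PowerSeries F) a * hf

theorem mul {M N : ℕ} {c d : F} {f g : F[X]} (hf : IsAtkinLehnerEigen M c f)
    (hg : IsAtkinLehnerEigen N d g) : IsAtkinLehnerEigen (M + N) (c * d) (f * g) := by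
  unfold IsAtkinLehnerEigen at *
  rw [map_mul, map_mul, map_mul, mul_add, pow_add]
  linear_combination aeval (atkinLehner F) g * (1 + PowerSeries.X) ^ (2 * N) * hf +
    PowerSeries.C c * aeval PowerSeries.X f * hg

theorem one : IsAtkinLehnerEigen 0 (1 : F) 1 := by
  simp [IsAtkinLehnerEigen]

theorem pow {N : ℕ} {c : F} {f : F[X]} (hf : IsAtkinLehnerEigen N c f) (n : ℕ) :
    IsAtkinLehnerEigen (n * N) (c ^ n) (f ^ n) := by
  induction n with
  | zero => simpa using one
  | succ n ih =>
    rw [pow_succ, pow_succ, Nat.succ_mul]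
    exact ih.mul hf

end IsAtkinLehnerEigen

theorem powerSeries_C_ofNat (n : ℕ) [n.AtLeastTwo] :
    (PowerSeries.C (OfNat.ofNat n : F)) = OfNat.ofNat n := map_ofNat _ n

theorem C_inv_eight_mul (h2 : (2 : F) ≠ 0) : PowerSeries.C (8⁻¹ : F) * 8 = 1 := by
  have h8 : (8 : F) ≠ 0 := by
    rw [show (8 : F) = 2 ^ 3 by norm_num]; exact pow_ne_zero 3 h2
  rw [← powerSeries_C_ofNat 8, ← map_mul, inv_mul_cancel₀ h8, map_one]

theorem C_nine_div_eight : PowerSeries.C (9 / 8 : F) = 9 * PowerSeries.C 8⁻¹ := by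
  rw [div_eq_mul_inv, map_mul, powerSeries_C_ofNat]

theorem isAtkinLehnerEigen_one_add_X (h2 : (2 : F) ≠ 0) :
    IsAtkinLehnerEigen 1 (9 / 8 : F) (1 + X) := by
  have h8 := C_inv_eight_mul h2
  have hw := one_add_X_inv_mul F
  simp only [IsAtkinLehnerEigen, map_add, map_one, aeval_X, atkinLehner, C_nine_div_eight]
  set e := PowerSeries.C (8⁻¹ : F)
  set x : PowerSeries F := PowerSeries.X
  set w := (1 + x)⁻¹
  linear_combination e * (1 - 8 * x) * (1 + x) * hw - (1 + x) ^ 2 * h8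

theorem isAtkinLehnerEigen_X_mul (h2 : (2 : F) ≠ 0) :
    IsAtkinLehnerEigen 1 (9 / 8 : F) (X * (1 - 8 * X)) := by
  have h8 := C_inv_eight_mul h2
  have hw := one_add_X_inv_mul F
  simp only [IsAtkinLehnerEigen, map_mul, map_sub, map_ofNat, map_one, aeval_X, atkinLehner,
    C_nine_div_eight]
  set e := PowerSeries.C (8⁻¹ : F)
  set x : PowerSeries F := PowerSeries.X
  set w := (1 + x)⁻¹
  linear_combination e * (1 - 8 * x) * (1 + x) * hw -
    8 * e ^ 2 * (1 - 8 * x) ^ 2 * (w * (1 + x) + 1) * hw - e * (1 - 8 * x) ^ 2 * h8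

/-- The roots of 1 - 16x - 8x² are the fixed points of the involution, which is where t ramifies. -/
theorem isAtkinLehnerEigen_sqrt (h2 : (2 : F) ≠ 0) :
    IsAtkinLehnerEigen 1 (-(9 / 8) : F) (1 - 16 * X - 8 * X ^ 2) := by
  have h8 := C_inv_eight_mul h2
  have hw := one_add_X_inv_mul F
  simp only [IsAtkinLehnerEigen, map_mul, map_sub, map_ofNat, map_one, map_pow, aeval_X,
    atkinLehner, C_nine_div_eight, map_neg]
  set e := PowerSeries.C (8⁻¹ : F)
  set x : PowerSeries F := PowerSeries.X
  set w := (1 + x)⁻¹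
  linear_combination - 16 * e * (1 - 8 * x) * (1 + x) * hw -
    8 * e ^ 2 * (1 - 8 * x) ^ 2 * (w * (1 + x) + 1) * hw - e * (1 - 8 * x) ^ 2 * h8 -
    (1 + x) ^ 2 * h8

/-- The involution sends 0 to 1/8, so vanishing at 0 forces vanishing at 1/8. The quotient by the
eigenvector x(1 - 8x) is again an eigenvector. -/
theorem IsAtkinLehnerEigen.exists_eq_mul (h2 : (2 : F) ≠ 0) (h3 : (3 : F) ≠ 0) {N : ℕ} {c : F}
    {f : F[X]} (hf : IsAtkinLehnerEigen (N + 1) (c * (9 / 8)) f)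
    (hdeg : f.natDegree ≤ 2 * (N + 1)) (h0 : f.coeff 0 = 0) :
    ∃ g, f = X * (1 - 8 * X) * g ∧ g.natDegree ≤ 2 * N ∧ IsAtkinLehnerEigen N c g := by
  have h8 : (8 : F) ≠ 0 := by
    rw [show (8 : F) = 2 ^ 3 by norm_num]; exact pow_ne_zero 3 h2
  have h9 : (9 : F) ≠ 0 := by
    rw [show (9 : F) = 3 ^ 2 by norm_num]; exact pow_ne_zero 2 h3
  have hroot : f.eval 8⁻¹ = 0 := by
    have h := congrArg (PowerSeries.constantCoeff (R := F)) hf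
    rw [aeval_powerSeries_X, map_mul, map_mul, ← PowerSeries.coeff_zero_eq_constantCoeff_apply,
      ← PowerSeries.coeff_zero_eq_constantCoeff_apply, ← PowerSeries.coeff_zero_eq_constantCoeff_apply,
      ← PowerSeries.coeff_zero_eq_constantCoeff_apply, Polynomial.coeff_coe, h0, mul_zero,
      PowerSeries.coeff_zero_eq_constantCoeff_apply, PowerSeries.coeff_zero_eq_constantCoeff_apply,
      aeval_def, hom_eval₂] at h
    simpa [atkinLehner, eval₂_id, PowerSeries.algebraMap_eq] using h
  obtain ⟨g₁, rfl⟩ := X_dvd_iff.2 h0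
  obtain ⟨g₂, rfl⟩ : X - C 8⁻¹ ∣ g₁ := by
    rw [dvd_iff_isRoot, IsRoot]
    simpa [h8] using hroot
  have hC : (8 : F[X]) * C 8⁻¹ = 1 := by
    rw [← map_ofNat C 8, ← Polynomial.C_mul, mul_inv_cancel₀ h8, C_1]
  have e : X * ((X - C 8⁻¹) * g₂) = X * (1 - 8 * X) * (C (-8⁻¹) * g₂) := by
    rw [C_neg]
    linear_combination -X ^ 2 * g₂ * hC
  refine ⟨C (-8⁻¹) * g₂, e, ?_, ?_⟩
  · refine (natDegree_C_mul_le _ _).trans ?_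
    rcases eq_or_ne g₂ 0 with rfl | hg
    · simp
    · rw [natDegree_mul X_ne_zero (mul_ne_zero (X_sub_C_ne_zero _) hg),
        natDegree_mul (X_sub_C_ne_zero _) hg, natDegree_X, natDegree_X_sub_C] at hdeg
      omega
  · rw [e] at hf
    have hs := isAtkinLehnerEigen_X_mul h2
    unfold IsAtkinLehnerEigen at hf hs ⊢
    have hu : PowerSeries.C (9 / 8 : F) *
        aeval (PowerSeries.X : PowerSeries F) (X * (1 - 8 * X) : F[X]) ≠ 0 := by
      refine mul_ne_zero ?_ ?_
      · simpa using div_ne_zero h9 h8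
      · simp only [map_mul, map_sub, map_one, map_ofNat, aeval_X]
        refine mul_ne_zero PowerSeries.X_ne_zero fun h => ?_
        simpa using congrArg (PowerSeries.constantCoeff (R := F)) h
    apply mul_left_cancel₀ hu
    rw [map_mul (aeval (atkinLehner F)), map_mul (aeval PowerSeries.X), map_mul PowerSeries.C,
      mul_add, pow_add] at hf
    linear_combination hf - aeval (atkinLehner F) (C (-8⁻¹) * g₂) *
      (1 + PowerSeries.X) ^ (2 * N) * hs

/-- Subtracting f(0)(1 + x)^N leaves an eigenvector vanishing at 0. Dividing it by x(1 - 8x) = t(1 +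
x) lowers N by one. -/
theorem IsAtkinLehnerEigen.exists_even (h2 : (2 : F) ≠ 0) (h3 : (3 : F) ≠ 0) (N : ℕ) {f : F[X]}
    (hf : IsAtkinLehnerEigen N ((9 / 8) ^ N) f) (hdeg : f.natDegree ≤ 2 * N) :
    ∃ B : F[X], B.natDegree ≤ N ∧
      aeval PowerSeries.X f = (1 + PowerSeries.X) ^ N * aeval (aperyParam F) B := by
  induction N generalizing f with
  | zero =>
    obtain ⟨b, rfl⟩ := natDegree_eq_zero.1 (Nat.le_zero.1 hdeg)
    exact ⟨C b, by simp, by simp⟩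
  | succ N ih =>
    have hb := ((isAtkinLehnerEigen_one_add_X h2).pow (N + 1)).C_mul (f.coeff 0)
    rw [mul_one] at hb
    have hs := hf.sub hb
    rw [pow_succ (9 / 8 : F)] at hs
    obtain ⟨g, hg, hgd, hgs⟩ := hs.exists_eq_mul h2 h3
      (natDegree_sub_le_of_le hdeg ((natDegree_C_mul_le _ _).trans
        ((natDegree_pow_le_of_le (N + 1) (show (1 + X : F[X]).natDegree ≤ 1 by compute_degree)).trans
        (by omega))) |>.trans (max_self _).le)
      (by simp [coeff_zero_eq_eval_zero])
    obtain ⟨B, hB, hBe⟩ := ih hgs hgd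
    refine ⟨C (f.coeff 0) + X * B, ?_, ?_⟩
    · refine (natDegree_add_le_of_degree_le (n := N + 1) (by simp) ?_)
      exact natDegree_mul_le.trans (by have := natDegree_X_le (R := F); omega)
    · have h := congrArg (aeval (PowerSeries.X : PowerSeries F)) hg
      simp only [map_sub, map_mul, map_add, map_pow, map_one, map_ofNat, aeval_X, aeval_C, hBe] at h ⊢
      have hw := one_add_X_inv_mul F
      rw [aperyParam] at *
      linear_combination h - PowerSeries.X * (1 - 8 * PowerSeries.X) * (1 + PowerSeries.X) ^ N *
        aeval (PowerSeries.X * (1 - 8 * PowerSeries.X) * (1 + PowerSeries.X)⁻¹) B * hw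

theorem IsAtkinLehnerEigen.exists_odd (h2 : (2 : F) ≠ 0) (h3 : (3 : F) ≠ 0) (N : ℕ) {f : F[X]}
    (hf : IsAtkinLehnerEigen (N + 1) (-(9 / 8) ^ (N + 1)) f) (hdeg : f.natDegree ≤ 2 * (N + 1)) :
    ∃ B : F[X], B.natDegree ≤ N ∧ aeval PowerSeries.X f =
      (1 - 16 * PowerSeries.X - 8 * PowerSeries.X ^ 2) * (1 + PowerSeries.X) ^ N *
        aeval (aperyParam F) B := by
  have step : ∀ (M : ℕ) (f : F[X]), IsAtkinLehnerEigen (M + 1) (-(9 / 8) ^ (M + 1)) f →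
      f.natDegree ≤ 2 * (M + 1) → ∃ g : F[X],
      f = C (f.coeff 0) * ((1 + X) ^ M * (1 - 16 * X - 8 * X ^ 2)) + X * (1 - 8 * X) * g ∧
      g.natDegree ≤ 2 * M ∧ IsAtkinLehnerEigen M (-(9 / 8) ^ M) g := by
    intro M f hf hdeg
    have hb := (((isAtkinLehnerEigen_one_add_X h2).pow M).mul
      (isAtkinLehnerEigen_sqrt h2)).C_mul (f.coeff 0)
    rw [mul_one, mul_neg, ← pow_succ] at hb
    have hs := hf.sub hb
    rw [pow_succ (9 / 8 : F), ← neg_mul] at hs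
    obtain ⟨g, hg, hgd, hgs⟩ := hs.exists_eq_mul h2 h3
      (natDegree_sub_le_of_le hdeg ((natDegree_C_mul_le _ _).trans
        (natDegree_mul_le_of_le
          (natDegree_pow_le_of_le M (show (1 + X : F[X]).natDegree ≤ 1 by compute_degree))
          (show (1 - 16 * X - 8 * X ^ 2 : F[X]).natDegree ≤ 2 by compute_degree) |>.trans
        (by omega))) |>.trans (max_self _).le)
      (by simp [coeff_zero_eq_eval_zero])
    exact ⟨g, by rw [← hg]; ring, hgd, hgs⟩
  induction N generalizing f with
  | zero =>
    obtain ⟨g, hg, hgd, hgs⟩ := step 0 f hf hdeg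
    obtain ⟨b, rfl⟩ := natDegree_eq_zero.1 (Nat.le_zero.1 hgd)
    -- The remaining constant is both fixed and negated by the involution, and 2 is invertible.
    have hb : b = 0 := by
      have h : PowerSeries.C b = PowerSeries.C (-b) := by
        simpa [IsAtkinLehnerEigen, PowerSeries.algebraMap_eq] using hgs
      have h := PowerSeries.C_injective h
      have : 2 * b = 0 := by linear_combination h
      simpa [h2] using this
    subst hb
    refine ⟨C (f.coeff 0), by simp, ?_⟩
    have h := congrArg (aeval (PowerSeries.X : PowerSeries F)) hg
    simp only [map_sub, map_mul, map_add, map_pow, map_one, map_ofNat, map_zero, aeval_X,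
      aeval_C] at h ⊢
    linear_combination h
  | succ N ih =>
    obtain ⟨g, hg, hgd, hgs⟩ := step (N + 1) f hf hdeg
    obtain ⟨B, hB, hBe⟩ := ih hgs hgd
    refine ⟨C (f.coeff 0) + X * B, ?_, ?_⟩
    · refine (natDegree_add_le_of_degree_le (n := N + 1) (by simp) ?_)
      exact natDegree_mul_le.trans (by have := natDegree_X_le (R := F); omega)
    · have h := congrArg (aeval (PowerSeries.X : PowerSeries F)) hg
      simp only [map_sub, map_mul, map_add, map_pow, map_one, map_ofNat, aeval_X, aeval_C, hBe] at h ⊢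
      have hw := one_add_X_inv_mul F
      rw [aperyParam] at *
      linear_combination h - PowerSeries.X * (1 - 8 * PowerSeries.X) * (1 + PowerSeries.X) ^ N *
        (1 - 16 * PowerSeries.X - 8 * PowerSeries.X ^ 2) *
        aeval (PowerSeries.X * (1 - 8 * PowerSeries.X) * (1 + PowerSeries.X)⁻¹) B * hw

end Descent

/-! ### From the Heun equation to the Apéry equation -/

/-- The series t is nonzero without constant term, so the coefficients of P can be peeled off one by
one. -/
theorem aeval_aperyParam_injective (F : Type*) [Field F] :
    Function.Injective (aeval (aperyParam F) : F[X] →ₐ[F] PowerSeries F) := by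
  have unit : ∀ a : PowerSeries F, PowerSeries.constantCoeff a = 1 → a ≠ 0 := by
    rintro a ha rfl
    simp at ha
  have h0 : aperyParam F ≠ 0 :=
    mul_ne_zero (mul_ne_zero PowerSeries.X_ne_zero (unit _ (by simp))) (unit _ (by simp))
  rw [injective_iff_map_eq_zero]
  intro P hP
  ext n
  induction n generalizing P with
  | zero =>
    have h := congrArg (PowerSeries.constantCoeff (R := F)) hP
    rw [aeval_def, hom_eval₂] at h
    simpa [aperyParam, PowerSeries.algebraMap_eq, eval₂_id, coeff_zero_eq_eval_zero] using h
  | succ n ih =>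
    have hc : P.coeff 0 = 0 := by
      have h := congrArg (PowerSeries.constantCoeff (R := F)) hP
      rw [aeval_def, hom_eval₂] at h
      simpa [aperyParam, PowerSeries.algebraMap_eq, eval₂_id, coeff_zero_eq_eval_zero] using h
    obtain ⟨Q, rfl⟩ := X_dvd_iff.2 hc
    rw [map_mul, aeval_X] at hP
    rw [coeff_X_mul]
    exact ih Q ((mul_eq_zero.1 hP).resolve_left h0)

theorem heun_derivative {F : Type*} [Field F] {f : F[X]}
    (h : X * (1 - 8 * X) * (1 + X) * derivative (derivative f) +
      (1 - 14 * X - 24 * X ^ 2) * derivative f - (2 + 8 * X) * f = 0) :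
    X * (1 - 8 * X) * (1 + X) * derivative (derivative (derivative f)) +
      2 * (1 - 14 * X - 24 * X ^ 2) * derivative (derivative f) -
      (16 + 56 * X) * derivative f - 8 * f = 0 := by
  have h' := congrArg derivative h
  simp only [derivative_mul, derivative_add, derivative_sub, derivative_X, derivative_one,
    derivative_ofNat, derivative_X_pow, derivative_zero] at h'
  norm_num at h'
  simp only [map_ofNat] at h'
  linear_combination h'

/-- If `C (x (1 - 8 x) / (1 + x)) = f ^ 2 / (1 + x) ^ (p - 1)` with `f` a solution of the Heun
equation, then `C` satisfies the Apéry equation. -/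
theorem apery_ode_of_pullback {p : ℕ} [Fact p.Prime] {f P : (ZMod p)[X]}
    (h : X * (1 - 8 * X) * (1 + X) * derivative (derivative f) +
      (1 - 14 * X - 24 * X ^ 2) * derivative f - (2 + 8 * X) * f = 0)
    (hP : (1 + PowerSeries.X) ^ p * aeval (aperyParam (ZMod p)) P =
      (1 + PowerSeries.X) * aeval PowerSeries.X f ^ 2) :
    X ^ 2 * (X ^ 2 - 34 * X + 1) * derivative (derivative (derivative P)) +
      (6 * X ^ 3 - 153 * X ^ 2 + 3 * X) * derivative (derivative P) +
      (7 * X ^ 2 - 112 * X + 1) * derivative P + (X - 5) * P = 0 := by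
  let D := PowerSeries.derivative (ZMod p)
  obtain ⟨x, hxX⟩ : ∃ x : PowerSeries (ZMod p), x = PowerSeries.X := ⟨_, rfl⟩
  obtain ⟨t, htt⟩ : ∃ t, t = aperyParam (ZMod p) := ⟨_, rfl⟩
  obtain ⟨w, hww⟩ : ∃ w : PowerSeries (ZMod p), w = (1 + PowerSeries.X)⁻¹ := ⟨_, rfl⟩
  have hx : D x = 1 := hxX ▸ PowerSeries.derivative_X
  have hw : w * (1 + x) = 1 := by rw [hww, hxX]; exact one_add_X_inv_mul _
  have ht : t = x * (1 - 8 * x) * w := by rw [htt, hxX, hww, aperyParam]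
  have e0 := hP
  rw [← hxX, ← htt] at e0
  have hDw : D w = -w ^ 2 := by
    have h := congrArg D hw
    rw [D.leibniz, map_add, D.map_one_eq_zero, hx, smul_eq_mul, smul_eq_mul] at h
    linear_combination w * h - D w * hw
  obtain ⟨t₁, ht₁⟩ : ∃ t₁, t₁ = (1 - 16 * x - 8 * x ^ 2) * w ^ 2 := ⟨_, rfl⟩
  obtain ⟨t₂, ht₂⟩ : ∃ t₂, t₂ = -18 * w ^ 3 := ⟨_, rfl⟩
  obtain ⟨t₃, ht₃⟩ : ∃ t₃, t₃ = 54 * w ^ 4 := ⟨_, rfl⟩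
  have dt : D t = t₁ := by
    rw [ht, ht₁]
    simp only [D.leibniz, map_sub, D.map_ofNat, D.map_one_eq_zero, hx, hDw, smul_eq_mul]
    linear_combination -(1 - 16 * x) * w * hw
  have dt₁ : D t₁ = t₂ := by
    rw [ht₁, ht₂]
    simp only [D.leibniz, D.leibniz_pow, map_sub, D.map_ofNat, D.map_one_eq_zero, hx, hDw,
      smul_eq_mul, nsmul_eq_mul]
    push_cast
    linear_combination 16 * w ^ 2 * (1 + w * (1 + x)) * hw - 16 * w ^ 2 * (1 + x) * w * hw +
      16 * x * w ^ 2 * hw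
  have dt₂ : D t₂ = t₃ := by
    rw [ht₂, ht₃, neg_mul, map_neg, D.map_ofNat_mul, D.leibniz_pow, hDw]
    simp only [smul_eq_mul, nsmul_eq_mul]
    push_cast
    ring
  have dx : ∀ Q : (ZMod p)[X], D (aeval x Q) = aeval x (derivative Q) := fun Q => by
    rw [D.map_aeval, hx, smul_eq_mul, mul_one]
  have dP : ∀ Q : (ZMod p)[X], D (aeval t Q) = aeval t (derivative Q) * t₁ := fun Q => by
    rw [D.map_aeval, dt, smul_eq_mul]
  -- `e1`, `e2`, `e3` are successive derivatives of `e0`; the factor (1 + x)^p is constant for D.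
  have e1 : (1 + x) ^ p * (aeval t (derivative P) * t₁) =
      aeval x f ^ 2 + 2 * (1 + x) * aeval x f * aeval x (derivative f) := by
    have h := congrArg D e0
    rw [D.map_pow_char_mul, dP, D.leibniz, D.leibniz_pow, dx, map_add, D.map_one_eq_zero, hx] at h
    rw [h]
    simp only [smul_eq_mul, nsmul_eq_mul]
    push_cast
    ring
  have e2 : (1 + x) ^ p * (aeval t (derivative (derivative P)) * t₁ ^ 2 +
      aeval t (derivative P) * t₂) = 4 * aeval x f * aeval x (derivative f) +
      2 * (1 + x) * (aeval x (derivative f) ^ 2 +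
        aeval x f * aeval x (derivative (derivative f))) := by
    have h := congrArg D e1
    rw [D.map_pow_char_mul, D.leibniz, dP, dt₁, map_add, D.leibniz_pow, dx, mul_assoc 2, mul_assoc 2,
      D.map_ofNat_mul, D.leibniz, D.leibniz, dx, dx, map_add, D.map_one_eq_zero, hx] at h
    simp only [smul_eq_mul, nsmul_eq_mul] at h
    push_cast at h
    linear_combination h
  have e3 : (1 + x) ^ p * (aeval t (derivative (derivative (derivative P))) * t₁ ^ 3 +
      3 * aeval t (derivative (derivative P)) * t₁ * t₂ + aeval t (derivative P) * t₃) =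
      6 * (aeval x (derivative f) ^ 2 + aeval x f * aeval x (derivative (derivative f))) +
      2 * (1 + x) * (3 * aeval x (derivative f) * aeval x (derivative (derivative f)) +
        aeval x f * aeval x (derivative (derivative (derivative f)))) := by
    have h := congrArg D e2
    rw [D.map_pow_char_mul, map_add, D.leibniz, D.leibniz, dP, dP, dt₂, D.leibniz_pow, dt₁, map_add,
      mul_assoc 4, mul_assoc 2, D.map_ofNat_mul, D.map_ofNat_mul, D.leibniz, D.leibniz, dx, dx,
      map_add, map_add, D.map_one_eq_zero, hx, D.leibniz_pow, D.leibniz, dx, dx, dx] at h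
    simp only [smul_eq_mul, nsmul_eq_mul] at h
    push_cast at h
    linear_combination h
  have f2 := congrArg (aeval x) h
  have f3 := congrArg (aeval x) (heun_derivative h)
  apply aeval_aperyParam_injective
  rw [← htt]
  apply IsFractionRing.injective (PowerSeries (ZMod p)) (FractionRing (PowerSeries (ZMod p)))
  let φ := algebraMap (PowerSeries (ZMod p)) (FractionRing (PowerSeries (ZMod p)))
  have hφ : ∀ a : PowerSeries (ZMod p), a ≠ 0 → φ a ≠ 0 := fun a ha =>
    (map_ne_zero_iff φ (IsFractionRing.injective _ _)).2 ha
  have unit : ∀ a : PowerSeries (ZMod p), PowerSeries.constantCoeff a = 1 → a ≠ 0 := by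
    rintro a ha rfl
    simp at ha
  have n1 := hφ x (hxX ▸ PowerSeries.X_ne_zero)
  have n2 := hφ (1 - 8 * x) (unit _ (by simp [hxX]))
  have n3 := hφ (1 - 16 * x - 8 * x ^ 2) (unit _ (by simp [hxX]))
  have n4 := hφ ((1 + x) ^ p) (unit _ (by simp [hxX]))
  replace hw := congrArg φ hw
  replace ht := congrArg φ ht
  replace ht₁ := congrArg φ ht₁
  replace ht₂ := congrArg φ ht₂
  replace ht₃ := congrArg φ ht₃
  replace e0 := congrArg φ e0
  replace e1 := congrArg φ e1
  replace e2 := congrArg φ e2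
  replace e3 := congrArg φ e3
  replace f2 := congrArg φ f2
  replace f3 := congrArg φ f3
  simp only [map_add, map_sub, map_mul, map_pow, map_one, map_zero, map_ofNat, map_neg, aeval_X]
    at hw ht ht₁ ht₂ ht₃ e0 e1 e2 e3 f2 f3 n1 n2 n3 n4 ⊢
  exact apery_pullback_identity hw n1 n2 n3 n4 ht ht₁ ht₂ ht₃ f2 f3 e0 e1 e2 e3

theorem eq_aperyTrunc_of_pullback {p : ℕ} [Fact p.Prime] {f P : (ZMod p)[X]}
    (h : X * (1 - 8 * X) * (1 + X) * derivative (derivative f) +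
      (1 - 14 * X - 24 * X ^ 2) * derivative f - (2 + 8 * X) * f = 0)
    (h0 : f.coeff 0 = 1) (hdeg : P.natDegree < p)
    (hP : (1 + PowerSeries.X) ^ p * aeval (aperyParam (ZMod p)) P =
      (1 + PowerSeries.X) * aeval PowerSeries.X f ^ 2) : aperyTrunc p = P := by
  refine eq_aperyTrunc_of_ode hdeg (apery_ode_of_pullback h hP) ?_
  have hc := congrArg (PowerSeries.constantCoeff (R := ZMod p)) hP
  rw [map_mul, map_mul, map_pow, map_pow, aeval_def, aeval_def, hom_eval₂, hom_eval₂] at hc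
  simpa [aperyParam, PowerSeries.algebraMap_eq, eval₂_id, ← coeff_zero_eq_eval_zero, h0] using hc

/-! ### The Legendre polynomial modulo p and the sign under the involution -/

/-- The Legendre polynomial of degree `m` on `[0, 1]`, over a field. -/
noncomputable def legendreOver (F : Type*) [Field F] (m : ℕ) : F[X] :=
  (shiftedLegendre m).map (algebraMap ℤ F)

section Legendre
variable {F A : Type*} [Field F] [CommRing A] [Algebra F A]

theorem aeval_legendreOver (m : ℕ) (s : A) :
    aeval s (legendreOver F m) = (-1) ^ m * aeval (1 - s) (legendreOver F m) := by
  rw [legendreOver, aeval_map_algebraMap, aeval_map_algebraMap, shiftedLegendre_eval_symm]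

theorem legendreOver_ode {m : ℕ} (hm : (9 * (m * (m + 1)) : F) = -2) (s : A) :
    9 * (s * (1 - s) * aeval s (derivative (derivative (legendreOver F m))) +
      (1 - 2 * s) * aeval s (derivative (legendreOver F m))) -
      2 * aeval s (legendreOver F m) = 0 := by
  have h := congrArg (aeval s) (shiftedLegendre_ode m)
  have hm' := congrArg (algebraMap F A) hm
  simp only [legendreOver, derivative_map, aeval_map_algebraMap]
  simp only [map_add, map_sub, map_mul, map_one, map_zero, map_ofNat, map_natCast, map_neg,
    aeval_X] at h hm'
  linear_combination 9 * h - aeval s (shiftedLegendre m) * hm'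

theorem coeff_zero_legendreOver (m : ℕ) : (legendreOver F m).coeff 0 = 1 := by
  simp [legendreOver, coeff_shiftedLegendre]

theorem natDegree_legendreOver_le (m : ℕ) : (legendreOver F m).natDegree ≤ m :=
  natDegree_map_le.trans (natDegree_shiftedLegendre m).le

end Legendre

/-- The factor 4/3 (1 + x) u is 1/(1 - 2ξ), so the second identity says that the involution carries
one cubic argument to 1 minus the other. -/
theorem atkinLehner_identities {K : Type*} [Field K] {x w u e ξ : K} (h2 : (2 : K) ≠ 0)
    (h3 : (3 : K) ≠ 0) (hw : w * (1 + x) = 1) (hu : u * (1 + 4 * x) = 1) (he : e * 8 = 1)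
    (hξ : ξ = e * (1 - 8 * x) * w) :
    4 * ((1 - 2 * ξ) * (1 + x)) = 3 * (1 + 4 * x) ∧
    27 * ξ ^ 2 * (4 / 3 * (1 + x) * u) ^ 3 = 1 - 27 * x * u ^ 3 := by
  obtain ⟨q, hq⟩ : ∃ q, q = 1 + x := ⟨_, rfl⟩
  obtain ⟨r, hr⟩ : ∃ r, r = 1 + 4 * x := ⟨_, rfl⟩
  rw [← hq] at hw ⊢
  rw [← hr] at hu ⊢
  have hq0 : q ≠ 0 := right_ne_zero_of_mul_eq_one hw
  have hr0 : r ≠ 0 := right_ne_zero_of_mul_eq_one hu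
  have h8 : (8 : K) ≠ 0 := by
    rw [show (8 : K) = 2 ^ 3 by norm_num]; exact pow_ne_zero 3 h2
  obtain rfl : w = 1 / q := eq_div_of_mul_eq hq0 hw
  obtain rfl : u = 1 / r := eq_div_of_mul_eq hr0 hu
  obtain rfl : e = 1 / 2 ^ 3 := by
    rw [eq_div_iff (pow_ne_zero 3 h2)]; linear_combination he
  rw [hξ]
  constructor
  · field_simp
    rw [hq, hr]
    ring
  · field_simp
    rw [hq, hr]
    ring

theorem isAtkinLehnerEigen_cubicPullback {p : ℕ} [Fact p.Prime] (h2 : (2 : ZMod p) ≠ 0)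
    (h3 : (3 : ZMod p) ≠ 0) {m N : ℕ} (hN : p - 1 = 2 * N) (hmp : 3 * m ≤ p - 1)
    (hm : (9 * (m * (m + 1)) : ZMod p) = -2) :
    IsAtkinLehnerEigen N ((-1) ^ m)
      (cubicPullback (legendreOver (ZMod p) m) (p - 1) (1 - 2 * X) (27 * X ^ 2)) := by
  have hdeg : 3 * (legendreOver (ZMod p) m).natDegree ≤ p - 1 :=
    (Nat.mul_le_mul_left 3 (natDegree_legendreOver_le m)).trans hmp
  obtain ⟨x, hxX⟩ : ∃ x : PowerSeries (ZMod p), x = PowerSeries.X := ⟨_, rfl⟩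
  obtain ⟨ξ, hξ⟩ : ∃ ξ, ξ = atkinLehner (ZMod p) := ⟨_, rfl⟩
  obtain ⟨u, hu⟩ : ∃ u : PowerSeries (ZMod p), u * (1 + 4 * x) = 1 :=
    ⟨_, PowerSeries.inv_mul_cancel _ (by simp [hxX])⟩
  obtain ⟨g, hg⟩ : ∃ g : PowerSeries (ZMod p), g * 3 = 4 := ⟨PowerSeries.C (4 / 3), by
    rw [← powerSeries_C_ofNat 3, ← map_mul, div_mul_cancel₀ _ h3, powerSeries_C_ofNat]⟩
  -- The stray factor h = 3/4 in 1 - 2ξ disappears in the power p - 1, by Fermat.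
  obtain ⟨h, hh⟩ : ∃ h : PowerSeries (ZMod p), h * 4 = 3 ∧ h ^ (p - 1) = 1 := by
    have h4 : (4 : ZMod p) ≠ 0 := by
      rw [show (4 : ZMod p) = 2 ^ 2 by norm_num]; exact pow_ne_zero 2 h2
    refine ⟨PowerSeries.C (3 / 4), ?_, ?_⟩
    · rw [← powerSeries_C_ofNat 4, ← map_mul, div_mul_cancel₀ _ h4, powerSeries_C_ofNat]
    · rw [← map_pow, ZMod.pow_card_sub_one_eq_one (div_ne_zero h3 h4), map_one]
  have key : (1 - 2 * ξ) * (1 + x) = h * (1 + 4 * x) ∧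
      27 * ξ ^ 2 * (g * (1 + x) * u) ^ 3 = 1 - 27 * x * u ^ 3 := by
    let φ := algebraMap (PowerSeries (ZMod p)) (FractionRing (PowerSeries (ZMod p)))
    have inj : Function.Injective φ := IsFractionRing.injective _ _
    have c2 : φ 2 ≠ 0 := by
      rw [map_ne_zero_iff φ inj, ← powerSeries_C_ofNat 2]
      simpa using h2
    have c3 : φ 3 ≠ 0 := by
      rw [map_ne_zero_iff φ inj, ← powerSeries_C_ofNat 3]
      simpa using h3
    have k1 := congrArg φ (one_add_X_inv_mul (ZMod p))
    have k2 := congrArg φ hu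
    have k3 := congrArg φ (C_inv_eight_mul h2)
    have k4 := congrArg φ hξ
    have k5 := congrArg φ hg
    have k6 := congrArg φ hh.1
    rw [atkinLehner] at k4
    rw [← hxX] at k1 k4
    simp only [map_add, map_sub, map_mul, map_one, map_ofNat] at c2 c3 k1 k2 k3 k4 k5 k6
    have k := atkinLehner_identities c2 c3 k1 k2 k3 k4
    constructor <;> apply inj <;>
      simp only [map_add, map_sub, map_mul, map_pow, map_one, map_ofNat]
    · apply mul_left_cancel₀ (show (4 : FractionRing (PowerSeries (ZMod p))) ≠ 0 by
        rw [show (4 : FractionRing (PowerSeries (ZMod p))) = 2 ^ 2 by norm_num]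
        exact pow_ne_zero 2 c2)
      linear_combination k.1 - (1 + 4 * φ x) * k6
    · rw [← k.2, eq_div_of_mul_eq c3 k5]
  have hv : g * (1 + x) * u * aeval ξ (1 - 2 * X : (ZMod p)[X]) = 1 := by
    simp only [map_sub, map_mul, map_one, map_ofNat, aeval_X]
    have hgh : g * h = 1 := by
      have h3' : (3 : PowerSeries (ZMod p)) ≠ 0 := by
        rw [← powerSeries_C_ofNat 3]
        simpa using h3
      apply mul_left_cancel₀ h3'
      linear_combination h * hg + hh.1
    linear_combination g * u * key.1 + g * h * hu + hgh
  have hu' : u * aeval x (1 + 4 * X : (ZMod p)[X]) = 1 := by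
    simpa only [map_add, map_mul, map_one, map_ofNat, aeval_X] using hu
  have e1 := aeval_cubicPullback hdeg _ (27 * X ^ 2) hv
  have e2 := aeval_cubicPullback hdeg _ (27 * X) hu'
  -- The involution leads from the first form of f to the second; their equality makes f an
  -- eigenvector.
  rw [← (cubicPullback_heun_and_eq p hdeg (legendreOver_ode hm)).2] at e2
  simp only [map_add, map_sub, map_mul, map_pow, map_one, map_ofNat, aeval_X] at e1 e2
  rw [aeval_legendreOver, key.2, sub_sub_cancel] at e1
  rw [IsAtkinLehnerEigen, ← hxX, ← hξ, e1, e2, ← hN, map_pow, map_neg, map_one]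
  have hpow := congrArg (· ^ (p - 1)) key.1
  simp only [mul_pow, hh.2, one_mul] at hpow
  linear_combination (-1) ^ m * aeval (27 * x * u ^ 3) (legendreOver (ZMod p) m) * hpow

theorem aperyTrunc_eq_sq_or {p : ℕ} [Fact p.Prime] (h2 : (2 : ZMod p) ≠ 0)
    (h3 : (3 : ZMod p) ≠ 0) {m N : ℕ} (hN : p = 2 * (N + 1) + 1) (hmp : 3 * m ≤ p - 1)
    (hm : (9 * (m * (m + 1)) : ZMod p) = -2) :
    ((-1) ^ m = (9 / 8 : ZMod p) ^ (N + 1) → ∃ B : (ZMod p)[X], aperyTrunc p = B ^ 2) ∧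
    ((-1) ^ m = -(9 / 8 : ZMod p) ^ (N + 1) →
      ∃ B : (ZMod p)[X], aperyTrunc p = (X ^ 2 - 34 * X + 1) * B ^ 2) := by
  have hdeg : 3 * (legendreOver (ZMod p) m).natDegree ≤ p - 1 :=
    (Nat.mul_le_mul_left 3 (natDegree_legendreOver_le m)).trans hmp
  have heun := (cubicPullback_heun_and_eq p hdeg (legendreOver_ode hm)).1
  have h0 : (cubicPullback (legendreOver (ZMod p) m) (p - 1) (1 - 2 * X)
      (27 * X ^ 2)).coeff 0 = 1 := by
    rw [coeff_zero_cubicPullback _ _ (by simp) (by simp), coeff_zero_legendreOver]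
  have hs := isAtkinLehnerEigen_cubicPullback h2 h3 (N := N + 1) (by omega) hmp hm
  have hd : (cubicPullback (legendreOver (ZMod p) m) (p - 1) (1 - 2 * X)
      (27 * X ^ 2)).natDegree ≤ p - 1 :=
    natDegree_cubicPullback_le hdeg (by compute_degree) (by compute_degree)
  rw [show p - 1 = 2 * (N + 1) by omega] at hd heun h0 hs
  generalize cubicPullback (legendreOver (ZMod p) m) (2 * (N + 1)) (1 - 2 * X) (27 * X ^ 2) = f at *
  have hpow : (1 + PowerSeries.X : PowerSeries (ZMod p)) ^ p =
      (1 + PowerSeries.X) * ((1 + PowerSeries.X) ^ (N + 1)) ^ 2 := by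
    rw [← pow_mul, ← pow_succ']
    congr 1
    omega
  constructor
  · intro hsign
    rw [hsign] at hs
    obtain ⟨B, hB, hBe⟩ := hs.exists_even h2 h3 _ hd
    refine ⟨B, eq_aperyTrunc_of_pullback heun h0 ?_ ?_⟩
    · have := natDegree_pow_le_of_le 2 hB
      omega
    · rw [hBe, hpow, map_pow]
      ring
  · intro hsign
    rw [hsign] at hs
    obtain ⟨B, hB, hBe⟩ := hs.exists_odd h2 h3 _ hd
    refine ⟨B, eq_aperyTrunc_of_pullback heun h0 ?_ ?_⟩
    · have h1 := natDegree_pow_le_of_le 2 hB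
      have h4 := natDegree_mul_le (p := (X ^ 2 - 34 * X + 1 : (ZMod p)[X])) (q := B ^ 2)
      have h5 : (X ^ 2 - 34 * X + 1 : (ZMod p)[X]).natDegree ≤ 2 := by compute_degree
      omega
    · rw [hBe, hpow]
      simp only [map_mul, map_add, map_sub, map_pow, map_one, map_ofNat, aeval_X]
      generalize aeval (aperyParam (ZMod p)) B = b
      have hw := one_add_X_inv_mul (ZMod p)
      -- This is where the factor t² - 34t + 1 arises.
      have hsq : (1 + PowerSeries.X) ^ 2 *
          (aperyParam (ZMod p) ^ 2 - 34 * aperyParam (ZMod p) + 1) =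
          (1 - 16 * PowerSeries.X - 8 * PowerSeries.X ^ 2) ^ 2 := by
        rw [aperyParam]
        generalize (PowerSeries.X : PowerSeries (ZMod p)) = x at *
        generalize (1 + x)⁻¹ = w at *
        linear_combination (x ^ 2 * (1 - 8 * x) ^ 2 * (w * (1 + x) + 1) -
          34 * x * (1 - 8 * x) * (1 + x)) * hw
      linear_combination (1 + PowerSeries.X) * ((1 + PowerSeries.X) ^ N) ^ 2 * b ^ 2 * hsq

/-! ### Signs and residues modulo 24 -/

theorem theorem2 (p : ℕ) (hp : p.Prime) :
    ∃ B : (ZMod p)[X],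
      ((p % 24 = 1 ∨ p % 24 = 5 ∨ p % 24 = 7 ∨ p % 24 = 11) →
        aperyTrunc p = B ^ 2) ∧
      ((p % 24 = 13 ∨ p % 24 = 17 ∨ p % 24 = 19 ∨ p % 24 = 23) →
        aperyTrunc p = (X ^ 2 - 34 * X + 1) * B ^ 2) := by
  have : Fact p.Prime := ⟨hp⟩
  rcases Nat.lt_or_ge 3 p with hp3 | hp3
  swap
  · have := hp.two_le
    -- For p = 2, 3 neither residue condition can hold.
    exact ⟨0, fun h => absurd h (by omega), fun h => absurd h (by omega)⟩
  have hodd : p % 2 = 1 := (hp.eq_two_or_odd).resolve_left (by omega)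
  have hmod3 : p % 3 ≠ 0 := fun h =>
    absurd ((Nat.prime_dvd_prime_iff_eq Nat.prime_three hp).1 (Nat.dvd_of_mod_eq_zero h)) (by omega)
  have h2 : (2 : ZMod p) ≠ 0 := by
    exact_mod_cast CharP.natCast_ne_zero_of_pos_of_lt (K := ZMod p) p (n := 2) (by omega) (by omega)
  have h3 : (3 : ZMod p) ≠ 0 := by
    exact_mod_cast CharP.natCast_ne_zero_of_pos_of_lt (K := ZMod p) p (n := 3) (by omega) hp3
  obtain ⟨N, hN⟩ : ∃ N, p = 2 * (N + 1) + 1 := ⟨(p - 3) / 2, by omega⟩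
  -- Since 9m(m + 1) + 2 = (3m + 1)(3m + 2), it suffices that one factor be p. As p is odd, m is
  -- even in the first case and odd in the second.
  obtain ⟨m, hmp, hm, hsign⟩ : ∃ m : ℕ, 3 * m ≤ p - 1 ∧ (9 * (m * (m + 1)) : ZMod p) = -2 ∧
      ((-1) ^ m : ZMod p) = if p % 3 = 1 then 1 else -1 := by
    have hp0 : (p : ZMod p) = 0 := CharP.cast_eq_zero _ p
    by_cases h : p % 3 = 1
    · refine ⟨(p - 1) / 3, by omega, ?_, ?_⟩
      · have e : p = 3 * ((p - 1) / 3) + 1 := by omega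
        generalize (p - 1) / 3 = m at e
        have e' := congrArg (Nat.cast : ℕ → ZMod p) e
        rw [hp0] at e'
        push_cast at e'
        linear_combination -(3 * m + 2) * e'
      · rw [if_pos h, Even.neg_one_pow (Nat.even_iff.2 (by omega))]
    · refine ⟨(p - 2) / 3, by omega, ?_, ?_⟩
      · have e : p = 3 * ((p - 2) / 3) + 2 := by omega
        generalize (p - 2) / 3 = m at e
        have e' := congrArg (Nat.cast : ℕ → ZMod p) e
        rw [hp0] at e'
        push_cast at e'
        linear_combination -(3 * m + 1) * e'
      · rw [if_neg h, Odd.neg_one_pow (Nat.odd_iff.2 (by omega))]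
  -- As 9 is a square and 8 = 2³, Euler's criterion makes this power the Legendre symbol of 2.
  have htwo : (9 / 8 : ZMod p) ^ (N + 1) = if p % 8 = 1 ∨ p % 8 = 7 then 1 else -1 := by
    have h9 : (9 : ZMod p) ^ (N + 1) = 1 := by
      rw [show (9 : ZMod p) = 3 ^ 2 by norm_num, ← pow_mul, show 2 * (N + 1) = p - 1 by omega,
        ZMod.pow_card_sub_one_eq_one h3]
    have h8 : (8 : ZMod p) ^ (N + 1) = (2 ^ (N + 1)) ^ 3 := by
      rw [← pow_mul, mul_comm, pow_mul]; norm_num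
    have hN' : N + 1 = p / 2 := by omega
    rw [div_pow, h9, h8, hN']
    split_ifs with h
    · rw [(ZMod.euler_criterion p h2).1 ((ZMod.exists_sq_eq_two_iff (by omega)).2 h)]
      norm_num
    · rw [(ZMod.pow_div_two_eq_neg_one_or_one p h2).resolve_left fun h' =>
        h ((ZMod.exists_sq_eq_two_iff (by omega)).1 ((ZMod.euler_criterion p h2).2 h'))]
      norm_num
  obtain ⟨heven, hodd'⟩ := aperyTrunc_eq_sq_or h2 h3 hN hmp hm
  rw [hsign, htwo] at heven hodd'
  -- The two signs agree exactly for p ≡ 1, 5, 7, 11 mod 24.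
  by_cases hc : p % 3 = 1 ↔ p % 8 = 1 ∨ p % 8 = 7
  · obtain ⟨B, hB⟩ := heven (by simp only [hc])
    refine ⟨B, fun _ => hB, fun h => ?_⟩
    omega
  · obtain ⟨B, hB⟩ := hodd' (by
      by_cases h : p % 3 = 1
      · have h' : ¬(p % 8 = 1 ∨ p % 8 = 7) := by tauto
        simp [h, h']
      · have h' : p % 8 = 1 ∨ p % 8 = 7 := by tauto
        simp [h, h'])
    refine ⟨B, fun h => ?_, fun _ => hB⟩
    omega
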